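/- Let $F_2$ be the free group on $x,y$. For a word $w\in F_2$ let $f_w\in\mathbb Z[s,u,t]$ be its trace polynomial, i.e. the unique polynomial such that $\operatorname{tr} w(A,B)=f_w(\operatorname{tr}A,\operatorname{tr}(AB),\operatorname{tr}B)$ for all $A,B\in \mathrm{SL}_2(R)$ and every commutative ring $R$; for a field $\mathbb F$ we also write $f_w$ for its image in $\mathbb F[s,u,t]$. A word is in canonical form if it is written as $w=x^{a_1}y^{b_1}\cdots x^{a_r}y^{b_r}$ with all integers $a_i,b_i$ nonzero; $r$ is then called its complexity. Two words $x^{a_1}y^{b_1}\cdots x^{a_r}y^{b_r}$ and $x^{c_1}y^{d_1}\cdots x^{c_{r'}}y^{d_{r'}}$ in canonical form are trace-similar if $r=r'$, the array $(|a_i|)$ is a rearrangement of $(|c_i|)$ and the array $(|b_i|)$ is a rearrangement of $(|d_i|)$. Proposition. Let $\mathbb F$ be a field and let $w=x^{a_1}y^{b_1}\cdots x^{a_r}y^{b_r}$ be a word in canonical form. Suppose that $f_w=h(q)$ over $\mathbb F$, where $q\in\mathbb F[s,u,t]$ and $h\in\mathbb F[z]$ is a nonzero polynomial of degree $n$. Then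 there is an integer $m\ge 0$ such that $r=nm$ and such that, if moreover $\operatorname{char}\mathbb F$ is $0$ or is larger than all $|a_i|$ and $|b_i|$, then $w$ is trace-similar to $v^n$ for some word $v$ in canonical form of complexity $m$. -/

import Mathlib

open Matrix MatrixGroups

namespace TraceWord

/-- The free group `F₂` on two generators. -/
abbrev F₂ : Type := FreeGroup (Fin 2)

/-- The first generator. -/
def x : F₂ := FreeGroup.of 0

/-- The second generator. -/
def y : F₂ := FreeGroup.of 1

/-- The value `w(A, B)` of a word at a pair of group elements. -/
def wordValue {G : Type*} [Group G] (w : F₂) (A B : G) : G := FreeGroup.lift ![A, B] w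

/-- `f ∈ ℤ[s, u, t]` (variables `s = X 0`, `u = X 1`, `t = X 2`) is a trace polynomial of `w`:
over every commutative ring, `tr (w(A, B)) = f (tr A, tr (A B), tr B)` for all `A, B ∈ SL₂`. -/
def IsTracePolynomial (w : F₂) (f : MvPolynomial (Fin 3) ℤ) : Prop :=
  ∀ (R : Type) [CommRing R] (A B : SL(2, R)),
    trace (wordValue w A B).1 =
      MvPolynomial.aeval ![trace A.1, trace (A * B).1, trace B.1] f

theorem sl_relations {R : Type} [CommRing R] (A B : Matrix (Fin 2) (Fin 2) R)
    (hA : A.det = 1) (hB : B.det = 1) :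
    A * A = trace A • A - 1 ∧
    B * A = (trace (A * B) - trace A * trace B) • 1 + trace B • A + trace A • B - A * B ∧
    B * (A * B) = (-trace A) • 1 + A + trace (A * B) • B ∧
    A.adjugate = trace A • 1 - A := by
  rw [Matrix.det_fin_two] at hA hB
  refine ⟨?_, ?_, ?_, ?_⟩ <;> ext i j <;> fin_cases i <;> fin_cases j <;>
    simp [Matrix.mul_apply, Matrix.trace_fin_two, Matrix.adjugate_fin_two] <;> grind

/-- Every value of a word at `A, B ∈ SL₂` is a combination of `1, A, B, A B` whose coefficients are
integer polynomials in `tr A, tr (A B), tr B`, independent of the ring. -/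
theorem exists_coefficients (L : List (Fin 2 × Bool)) :
    ∃ c₀ c₁ c₂ c₃ : MvPolynomial (Fin 3) ℤ, ∀ (R : Type) [CommRing R] (A B : SL(2, R)),
      (wordValue (FreeGroup.mk L) A B).1 =
        MvPolynomial.aeval ![trace A.1, trace (A * B).1, trace B.1] c₀ •
            (1 : Matrix (Fin 2) (Fin 2) R) +
          MvPolynomial.aeval ![trace A.1, trace (A * B).1, trace B.1] c₁ • A.1 +
          MvPolynomial.aeval ![trace A.1, trace (A * B).1, trace B.1] c₂ • B.1 +
          MvPolynomial.aeval ![trace A.1, trace (A * B).1, trace B.1] c₃ • (A.1 * B.1) := by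
  induction L with
  | nil =>
    refine ⟨1, 0, 0, 0, fun R _ A B => ?_⟩
    have h1 : wordValue (FreeGroup.mk []) A B = 1 := by
      rw [wordValue, ← FreeGroup.one_eq_mk, map_one]
    rw [h1]
    simp
  | cons p L ih =>
    obtain ⟨c₀, c₁, c₂, c₃, hc⟩ := ih
    obtain ⟨i, b⟩ := p
    have key : ∀ (R : Type) [CommRing R] (A B : SL(2, R)),
        (wordValue (FreeGroup.mk ((i, b) :: L)) A B).1 =
          (cond b (![A, B] i) (![A, B] i)⁻¹ : SL(2, R)).1 *
            (wordValue (FreeGroup.mk L) A B).1 := by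
      intro R _ A B
      have := Matrix.SpecialLinearGroup.coe_mul (cond b (![A, B] i) (![A, B] i)⁻¹ : SL(2, R))
        (wordValue (FreeGroup.mk L) A B)
      rw [← this]
      simp [wordValue]
    have left_mul : ∀ (R : Type) [CommRing R] (A B : SL(2, R)) (e₀ e₁ e₂ e₃ : R),
        A.1 * (e₀ • (1 : Matrix (Fin 2) (Fin 2) R) + e₁ • A.1 + e₂ • B.1 + e₃ • (A.1 * B.1)) =
          (-e₁) • (1 : Matrix (Fin 2) (Fin 2) R) + (e₀ + trace A.1 * e₁) • A.1 +
            (-e₃) • B.1 + (e₂ + trace A.1 * e₃) • (A.1 * B.1) ∧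
        B.1 * (e₀ • (1 : Matrix (Fin 2) (Fin 2) R) + e₁ • A.1 + e₂ • B.1 + e₃ • (A.1 * B.1)) =
          ((trace (A * B).1 - trace A.1 * trace B.1) * e₁ - e₂ - trace A.1 * e₃) •
              (1 : Matrix (Fin 2) (Fin 2) R) + (trace B.1 * e₁ + e₃) • A.1 +
            (e₀ + trace A.1 * e₁ + trace B.1 * e₂ + trace (A * B).1 * e₃) • B.1 +
            (-e₁) • (A.1 * B.1) := by
      intro R _ A B e₀ e₁ e₂ e₃
      obtain ⟨h1, h2, h3, -⟩ := sl_relations A.1 B.1 A.2 B.2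
      obtain ⟨h4, -⟩ := sl_relations B.1 A.1 B.2 A.2
      have h5 : A.1 * (A.1 * B.1) = trace A.1 • (A.1 * B.1) - B.1 := by
        rw [← mul_assoc, h1, sub_mul, one_mul, smul_mul_assoc]
      have h6 : (A * B).1 = A.1 * B.1 := rfl
      constructor
      · simp only [mul_add, mul_smul_comm, mul_one, h1, h5]
        module
      · simp only [mul_add, mul_smul_comm, mul_one, h2, h3, h4, h6]
        module
    have inv_mul : ∀ (R : Type) [CommRing R] (A : SL(2, R)) (M : Matrix (Fin 2) (Fin 2) R),
        (A⁻¹).1 * M = trace A.1 • M - A.1 * M := by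
      intro R _ A M
      obtain ⟨-, -, -, h⟩ := sl_relations A.1 A.1 A.2 A.2
      have h' : (A⁻¹).1 = A.1.adjugate := rfl
      rw [h', h, sub_mul, smul_mul_assoc, one_mul]
    let s : MvPolynomial (Fin 3) ℤ := MvPolynomial.X 0
    let u : MvPolynomial (Fin 3) ℤ := MvPolynomial.X 1
    let t : MvPolynomial (Fin 3) ℤ := MvPolynomial.X 2
    match i, b with
    | 0, true =>
      refine ⟨-c₁, c₀ + s * c₁, -c₃, c₂ + s * c₃, fun R _ A B => ?_⟩
      rw [key, hc]
      simp [(left_mul R A B _ _ _ _).1, s]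
    | 0, false =>
      refine ⟨s * c₀ + c₁, s * c₁ - (c₀ + s * c₁), s * c₂ + c₃, s * c₃ - (c₂ + s * c₃),
        fun R _ A B => ?_⟩
      rw [key, hc]
      simp only [cond_false, Matrix.cons_val_zero, inv_mul, (left_mul R A B _ _ _ _).1]
      simp only [s, map_add, map_sub, map_mul, MvPolynomial.aeval_X, Matrix.cons_val_zero]
      module
    | 1, true =>
      refine ⟨(u - s * t) * c₁ - c₂ - s * c₃, t * c₁ + c₃, c₀ + s * c₁ + t * c₂ + u * c₃, -c₁,
        fun R _ A B => ?_⟩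
      rw [key, hc]
      simp only [cond_true, Matrix.cons_val_one, Matrix.cons_val_fin_one,
        (left_mul R A B _ _ _ _).2]
      simp [s, u, t]
    | 1, false =>
      refine ⟨t * c₀ - ((u - s * t) * c₁ - c₂ - s * c₃), t * c₁ - (t * c₁ + c₃),
        t * c₂ - (c₀ + s * c₁ + t * c₂ + u * c₃), t * c₃ + c₁, fun R _ A B => ?_⟩
      rw [key, hc]
      simp only [cond_false, Matrix.cons_val_one, Matrix.cons_val_fin_one, inv_mul,
        (left_mul R A B _ _ _ _).2]
      simp only [s, u, t, map_add, map_sub, map_mul, MvPolynomial.aeval_X, Matrix.cons_val_zero,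
        Matrix.cons_val_one, Matrix.cons_val]
      module

/-- Every word has a trace polynomial. -/
theorem exists_isTracePolynomial (w : F₂) : ∃ f, IsTracePolynomial w f := by
  induction w using Quot.inductionOn with
  | h L =>
    obtain ⟨c₀, c₁, c₂, c₃, hc⟩ := exists_coefficients L
    refine ⟨2 * c₀ + MvPolynomial.X 0 * c₁ + MvPolynomial.X 2 * c₂ + MvPolynomial.X 1 * c₃,
      fun R _ A B => ?_⟩
    have h6 : (A * B).1 = A.1 * B.1 := rfl
    have h := congrArg trace (hc R A B)
    simp only [trace_add, trace_smul, trace_one, smul_eq_mul] at h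
    refine h.trans ?_
    simp [h6]
    ring

/-- A word has at most one trace polynomial. -/
theorem IsTracePolynomial.unique {w : F₂} {f g : MvPolynomial (Fin 3) ℤ}
    (hf : IsTracePolynomial w f) (hg : IsTracePolynomial w g) : f = g := by
  apply MvPolynomial.map_injective (Int.castRingHom ℂ) (RingHom.injective_int _)
  refine MvPolynomial.funext fun v => ?_
  obtain ⟨b, hb⟩ := IsAlgClosed.exists_root
    (Polynomial.X ^ 2 - Polynomial.C (v 1) * Polynomial.X + 1 : Polynomial ℂ) (by
      have : (Polynomial.X ^ 2 - Polynomial.C (v 1) * Polynomial.X + 1 : Polynomial ℂ).degree = 2 := by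
        compute_degree!
      rw [this]; norm_num)
  have hb' : b ^ 2 - v 1 * b + 1 = 0 := by simpa using hb
  have hb0 : b ≠ 0 := by
    rintro rfl
    simp at hb'
  let A : SL(2, ℂ) := ⟨!![v 0, -1; 1, 0], by simp [Matrix.det_fin_two]⟩
  let B : SL(2, ℂ) := ⟨!![0, b; -b⁻¹, v 2], by simp [Matrix.det_fin_two, hb0]⟩
  have hv : ![trace A.1, trace (A * B).1, trace B.1] = v := by
    have h6 : (A * B).1 = A.1 * B.1 := rfl
    funext i
    fin_cases i
    · simp [A, Matrix.trace_fin_two]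
    · simp [A, B, h6, Matrix.trace_fin_two]
      field_simp
      linear_combination hb'
    · simp [B, Matrix.trace_fin_two]
  have h := (hf ℂ A B).symm.trans (hg ℂ A B)
  rw [hv] at h
  simpa [MvPolynomial.eval_map, MvPolynomial.aeval_def] using h

/-- The trace polynomial `f_w ∈ ℤ[s, u, t]` of a word. -/
noncomputable def tracePolynomial (w : F₂) : MvPolynomial (Fin 3) ℤ :=
  (exists_isTracePolynomial w).choose

theorem tracePolynomial_spec (w : F₂) : IsTracePolynomial w (tracePolynomial w) :=
  (exists_isTracePolynomial w).choose_spec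

/-- The trace polynomial `f_w` with scalars changed to `F`. -/
noncomputable def tracePolynomialOver (F : Type*) [Field F] (w : F₂) : MvPolynomial (Fin 3) F :=
  MvPolynomial.map (Int.castRingHom F) (tracePolynomial w)

/-- The list `(a₁, b₁), …, (a_r, b_r)` is the canonical form of `w`: all `a_i, b_i` are nonzero and
`w = x ^ a₁ * y ^ b₁ * ⋯ * x ^ a_r * y ^ b_r`. (Such an expression is automatically reduced.) -/
def IsCanonicalForm (w : F₂) (l : List (ℤ × ℤ)) : Prop :=
  (∀ p ∈ l, p.1 ≠ 0 ∧ p.2 ≠ 0) ∧ w = (l.map fun p => x ^ p.1 * y ^ p.2).prod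

/-- The word `w` can be written in canonical form and its complexity, the number of syllables
`x ^ a * y ^ b`, is `r`. -/
def HasComplexity (w : F₂) (r : ℕ) : Prop :=
  ∃ l, IsCanonicalForm w l ∧ l.length = r

/-- Two words in canonical form are trace-similar: they have the same complexity, and the arrays of
the absolute values of the exponents of `x`, respectively of `y`, are rearrangements of
each other. -/
def TraceSimilar (w v : F₂) : Prop :=
  ∃ l l' : List (ℤ × ℤ), IsCanonicalForm w l ∧ IsCanonicalForm v l' ∧ l.length = l'.length ∧
    (l.map fun p => |p.1|).Perm (l'.map fun p => |p.1|) ∧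
    (l.map fun p => |p.2|).Perm (l'.map fun p => |p.2|)

end TraceWord

/-! ### Base change for words and trace polynomials. -/

namespace TraceWord

/-! View `f_w` as a polynomial in `u`. Take `A` upper and `B` lower triangular, with traces `s = e +
e⁻¹` and `t = d + d⁻¹` and with off-diagonal entries making `tr (A B)` the indeterminate. Each
syllable then raises the degree by one, so for `r > 0` the coefficient of `u ^ r` is `∏ S_{a_i-1}(s)
S_{b_i-1}(t)`, a nonzero product of rescaled Chebyshev polynomials (`coeff_syllableProd`,
`coeff_aeval_tracePolynomial`). If `f_w = h(q)`, comparing degrees in `u` gives `n ∣ r`, in any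
characteristic, and this product is a constant times an `n`-th power.

Freeze `t` at a value where its factors survive. For `ζ` a primitive `2d`-th root of unity, `d ≥ 2`,
the factor `S_{a-1}` vanishes at `ζ + ζ⁻¹` exactly when `d ∣ a`, and then simply, under the
hypothesis on the characteristic. Hence `n` divides the number of `a_i` divisible by `d`, for each
`d` among the `|a_i|`. Peeling off the largest entries shows that `(|a_i|)` is an `n`-fold
repetition (`exists_perm_flatten_replicate`). The same holds for `(|b_i|)`, and pairing the two
repeated blocks gives `v`. -/

theorem wordValue_map {G H : Type*} [Group G] [Group H] (φ : G →* H) (w : F₂) (A B : G) :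
    wordValue w (φ A) (φ B) = φ (wordValue w A B) := by
  have : FreeGroup.lift ![φ A, φ B] = φ.comp (FreeGroup.lift ![A, B]) := by
    ext i
    fin_cases i <;> simp
  exact DFunLike.congr_fun this w

/-- A trace polynomial computes traces over commutative rings in every universe. -/
theorem IsTracePolynomial.trace_eq {w : F₂} {f : MvPolynomial (Fin 3) ℤ}
    (hf : IsTracePolynomial w f) {R : Type*} [CommRing R] (A B : SL(2, R)) :
    trace (wordValue w A B).1 =
      MvPolynomial.aeval ![trace A.1, trace (A * B).1, trace B.1] f := by
  -- `IsTracePolynomial` speaks only of rings in `Type`. The subring generated by the eight entries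
  -- of `A` and `B` is a quotient of an integer polynomial ring, hence has a copy there.
  let φ : MvPolynomial (Fin 2 × Fin 2 × Fin 2) ℤ →+* R :=
    (MvPolynomial.aeval fun p => (![A, B] p.1).1 p.2.1 p.2.2).toRingHom
  let ψ : (MvPolynomial (Fin 2 × Fin 2 × Fin 2) ℤ ⧸ RingHom.ker φ) →+* R := RingHom.kerLift φ
  have hψ : Function.Injective ψ := RingHom.kerLift_injective φ
  let M (i : Fin 2) : Matrix (Fin 2) (Fin 2) (MvPolynomial (Fin 2 × Fin 2 × Fin 2) ℤ ⧸ RingHom.ker φ) :=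
    Matrix.of fun j k => Ideal.Quotient.mk _ (MvPolynomial.X (i, j, k))
  have hM (i : Fin 2) : ψ.mapMatrix (M i) = (![A, B] i).1 := by
    ext j k
    change RingHom.kerLift φ (Ideal.Quotient.mk _ (MvPolynomial.X (i, j, k))) = _
    rw [RingHom.kerLift_mk]
    simp [φ]
  have hdet (i : Fin 2) : (M i).det = 1 := by
    apply hψ
    rw [RingHom.map_det, hM, map_one]
    exact (![A, B] i).2
  let N (i : Fin 2) : SL(2, MvPolynomial (Fin 2 × Fin 2 × Fin 2) ℤ ⧸ RingHom.ker φ) :=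
    ⟨M i, hdet i⟩
  have hN (i : Fin 2) : SpecialLinearGroup.map ψ (N i) = ![A, B] i := Subtype.ext (hM i)
  have htr (C : SL(2, MvPolynomial (Fin 2 × Fin 2 × Fin 2) ℤ ⧸ RingHom.ker φ)) :
      ψ (trace C.1) = trace (SpecialLinearGroup.map ψ C).1 := by
    simp [Matrix.trace_fin_two]
  have hA : SpecialLinearGroup.map ψ (N 0) = A := hN 0
  have hB : SpecialLinearGroup.map ψ (N 1) = B := hN 1
  have h := congrArg ψ (hf _ (N 0) (N 1))
  rw [htr, ← wordValue_map, hA, hB] at h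
  rw [h, MvPolynomial.aeval_def, MvPolynomial.aeval_def, MvPolynomial.hom_eval₂]
  congr 1
  · exact RingHom.ext_int _ _
  · funext i
    fin_cases i
    · simp [htr, hA]
    · change ψ (trace (N 0 * N 1).1) = _
      rw [htr, map_mul, hA, hB]
      rfl
    · simp [htr, hB]

theorem aeval_tracePolynomialOver (F : Type*) [Field F] {R : Type*} [CommRing R] [Algebra F R]
    (w : F₂) (v : Fin 3 → R) :
    MvPolynomial.aeval v (tracePolynomialOver F w) = MvPolynomial.aeval v (tracePolynomial w) := by
  rw [tracePolynomialOver, MvPolynomial.aeval_def, MvPolynomial.eval₂_map, MvPolynomial.aeval_def]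
  congr 1
  exact RingHom.ext_int _ _

/-! ### Powers of triangular matrices and Chebyshev polynomials. -/

/-- The upper triangular matrix of determinant one with diagonal `e, e⁻¹`. -/
def upper {R : Type*} [CommRing R] (e : Rˣ) (c : R) : SL(2, R) :=
  ⟨!![(e : R), c; 0, (e⁻¹ : Rˣ)], by simp [Matrix.det_fin_two]⟩

/-- The lower triangular matrix of determinant one with diagonal `e, e⁻¹`. -/
def lower {R : Type*} [CommRing R] (e : Rˣ) (c : R) : SL(2, R) :=
  ⟨!![(e : R), 0; c, (e⁻¹ : Rˣ)], by simp [Matrix.det_fin_two]⟩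

theorem val_mul {R : Type*} [CommRing R] (A B : SL(2, R)) : (A * B).1 = A.1 * B.1 := rfl

theorem coe_upper {R : Type*} [CommRing R] (e : Rˣ) (c : R) :
    (upper e c).1 = !![(e : R), c; 0, (e⁻¹ : Rˣ)] := rfl

theorem coe_lower {R : Type*} [CommRing R] (e : Rˣ) (c : R) :
    (lower e c).1 = !![(e : R), 0; c, (e⁻¹ : Rˣ)] := rfl

/-- For `a ≥ 0`, `S_a(e + e⁻¹)` is the sum `e^a + e^(a-2) + ⋯ + e^(-a)`; this splits off its top
term. Running the three-term recurrence both ways covers all integers. -/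
theorem S_eval_units_add_inv {R : Type*} [CommRing R] (e : Rˣ) (a : ℤ) :
    (Polynomial.Chebyshev.S R a).eval ((e : R) + (e⁻¹ : Rˣ)) =
      (e⁻¹ : Rˣ) * (Polynomial.Chebyshev.S R (a - 1)).eval ((e : R) + (e⁻¹ : Rˣ)) +
        (e ^ a : Rˣ) := by
  have hr (n : ℤ) : (Polynomial.Chebyshev.S R (n + 1)).eval ((e : R) + (e⁻¹ : Rˣ)) =
      ((e : R) + (e⁻¹ : Rˣ)) * (Polynomial.Chebyshev.S R n).eval ((e : R) + (e⁻¹ : Rˣ)) -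
        (Polynomial.Chebyshev.S R (n - 1)).eval ((e : R) + (e⁻¹ : Rˣ)) := by
    rw [Polynomial.Chebyshev.S_add_one]
    simp
  have he : (e : R) * (e⁻¹ : Rˣ) = 1 := by simp
  induction a with
  | zero => simp
  | succ n ih =>
    have h3 := hr n
    have h4 : ((e ^ ((n : ℤ) + 1) : Rˣ) : R) = e * (e ^ (n : ℤ) : Rˣ) := by
      rw [_root_.zpow_add_one, Units.val_mul, mul_comm]
    rw [add_sub_cancel_right, h4]
    linear_combination h3 + e * ih +
      (Polynomial.Chebyshev.S R (n - 1)).eval ((e : R) + (e⁻¹ : Rˣ)) * he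
  | pred n ih =>
    have h3 := hr (-n - 1)
    have h4 : ((e ^ (-(n : ℤ) - 1) : Rˣ) : R) = (e⁻¹ : Rˣ) * (e ^ (-(n : ℤ)) : Rˣ) := by
      rw [_root_.zpow_sub_one, Units.val_mul, mul_comm]
    rw [sub_add_cancel] at h3
    rw [h4]
    linear_combination (e⁻¹ : Rˣ) * ih - (e⁻¹ : Rˣ) * h3 -
      (Polynomial.Chebyshev.S R (-n - 1)).eval ((e : R) + (e⁻¹ : Rˣ)) * he

theorem eq_zpow_of_succ {G : Type*} [Group G] {f : ℤ → G} {g : G} (h0 : f 0 = 1)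
    (h : ∀ a, f (a + 1) = f a * g) (a : ℤ) : g ^ a = f a := by
  induction a with
  | zero => simp [h0]
  | succ n ih => rw [_root_.zpow_add_one, ih, h]
  | pred n ih =>
    rw [_root_.zpow_sub_one, ih, ← sub_add_cancel (-(n : ℤ)) 1, h]
    simp

/-- The corner is formally `c (e^a - e^(-a)) / (e - e⁻¹)`; the polynomial form needs no division, so
`e = ±1` is allowed. -/
theorem upper_zpow {R : Type*} [CommRing R] (e : Rˣ) (c : R) (a : ℤ) :
    upper e c ^ a = upper (e ^ a)
      (c * (Polynomial.Chebyshev.S R (a - 1)).eval ((e : R) + (e⁻¹ : Rˣ))) := by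
  refine eq_zpow_of_succ (f := fun a : ℤ => upper (e ^ a)
    (c * (Polynomial.Chebyshev.S R (a - 1)).eval ((e : R) + (e⁻¹ : Rˣ)))) ?_ (fun a => ?_) a
  · ext i j
    fin_cases i <;> fin_cases j <;> simp [upper]
  · have h := S_eval_units_add_inv e a
    apply Subtype.ext
    rw [val_mul, coe_upper, coe_upper, coe_upper, Matrix.mul_fin_two, add_sub_cancel_right, h]
    ext i j
    fin_cases i <;> fin_cases j <;> simp [_root_.zpow_add, mul_comm]
    ring

theorem lower_zpow {R : Type*} [CommRing R] (e : Rˣ) (c : R) (a : ℤ) :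
    lower e c ^ a = lower (e ^ a)
      (c * (Polynomial.Chebyshev.S R (a - 1)).eval ((e : R) + (e⁻¹ : Rˣ))) := by
  refine eq_zpow_of_succ (f := fun a : ℤ => lower (e ^ a)
    (c * (Polynomial.Chebyshev.S R (a - 1)).eval ((e : R) + (e⁻¹ : Rˣ)))) ?_ (fun a => ?_) a
  · ext i j
    fin_cases i <;> fin_cases j <;> simp [lower]
  · have h := S_eval_units_add_inv e⁻¹ a
    rw [inv_inv, add_comm] at h
    apply Subtype.ext
    rw [val_mul, coe_lower, coe_lower, coe_lower, Matrix.mul_fin_two, add_sub_cancel_right, h]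
    ext i j
    fin_cases i <;> fin_cases j <;> simp [_root_.zpow_add, mul_comm]
    ring

/-! ### The leading coefficient in `u`. -/

/-- The product of the syllables `A ^ a * B ^ b`. -/
def syllableProd {G : Type*} [Group G] (A B : G) (l : List (ℤ × ℤ)) : G :=
  (l.map fun p => A ^ p.1 * B ^ p.2).prod

theorem wordValue_syllableProd {G : Type*} [Group G] (A B : G) (l : List (ℤ × ℤ)) :
    wordValue (syllableProd x y l) A B = syllableProd A B l := by
  simp [wordValue, syllableProd, map_list_prod, Function.comp_def, x, y]

/-- In one syllable only the top row involves `X`, linearly, with `X`-coefficient `P Q` in the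
corner. Left multiplication thus raises top-row degrees by at most one, and the bottom row stays one
degree behind. The exception `k ≠ 0` accounts for the entry `1` of the empty product. -/
theorem coeff_syllableProd {K : Type*} [Field K] (e d : Kˣ) (κ : K) (l : List (ℤ × ℤ)) :
    let M := (syllableProd (upper (Units.map Polynomial.C.toMonoidHom e) (Polynomial.X - Polynomial.C κ))
      (lower (Units.map Polynomial.C.toMonoidHom d) 1) l).1
    ((∀ k, l.length < k → (M 0 0).coeff k = 0) ∧
      (M 0 0).coeff l.length = (l.map fun p =>
        (Polynomial.Chebyshev.S K (p.1 - 1)).eval ((e : K) + (e⁻¹ : Kˣ)) *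
        (Polynomial.Chebyshev.S K (p.2 - 1)).eval ((d : K) + (d⁻¹ : Kˣ))).prod) ∧
    (∀ k, l.length < k → (M 0 1).coeff k = 0) ∧
    (∀ k, l.length ≤ k → (M 1 0).coeff k = 0) ∧
    (∀ k, l.length ≤ k → k ≠ 0 → (M 1 1).coeff k = 0) := by
  induction l with
  | nil =>
    simp only [syllableProd, List.map_nil, List.prod_nil, List.length_nil]
    refine ⟨⟨fun k hk => ?_, ?_⟩, fun k hk => ?_, fun k hk => ?_, fun k hk h0 => ?_⟩ <;>
      simp [Polynomial.coeff_one] <;> lia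
  | cons p l ih =>
    obtain ⟨a, b⟩ := p
    obtain ⟨⟨h1, h2⟩, h3, h4, h5⟩ := ih
    set N := syllableProd (upper (Units.map Polynomial.C.toMonoidHom e) (Polynomial.X - Polynomial.C κ))
      (lower (Units.map Polynomial.C.toMonoidHom d) 1) l with hN
    have hS (e : Kˣ) (a : ℤ) : (Polynomial.Chebyshev.S (Polynomial K) a).eval
        (((Units.map Polynomial.C.toMonoidHom e : (Polynomial K)ˣ) : Polynomial K) +
          ((Units.map Polynomial.C.toMonoidHom e)⁻¹ : (Polynomial K)ˣ)) =
        Polynomial.C ((Polynomial.Chebyshev.S K a).eval ((e : K) + (e⁻¹ : Kˣ))) := by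
      rw [← Polynomial.Chebyshev.map_S Polynomial.C, Polynomial.eval_map,
        ← Polynomial.eval₂_at_apply, Polynomial.C_add]
      rfl
    have hz (e : Kˣ) (a : ℤ) : (((Units.map Polynomial.C.toMonoidHom e) ^ a : (Polynomial K)ˣ) :
        Polynomial K) = Polynomial.C ((e ^ a : Kˣ) : K) := by
      rw [← map_zpow]
      rfl
    have hz' (e : Kˣ) (a : ℤ) : ((((Units.map Polynomial.C.toMonoidHom e) ^ a)⁻¹ : (Polynomial K)ˣ) :
        Polynomial K) = Polynomial.C (((e ^ a)⁻¹ : Kˣ) : K) := by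
      rw [← map_zpow, ← map_inv]
      rfl
    intro M
    have hM : M = (upper (Units.map Polynomial.C.toMonoidHom e) (Polynomial.X - Polynomial.C κ) ^ a *
      lower (Units.map Polynomial.C.toMonoidHom d) 1 ^ b).1 * N.1 := rfl
    rw [upper_zpow, lower_zpow, hS, hS] at hM
    rw [val_mul, coe_upper, coe_lower, hz, hz, hz', hz', Matrix.mul_fin_two] at hM
    set P := (Polynomial.Chebyshev.S K (a - 1)).eval ((e : K) + (e⁻¹ : Kˣ))
    set Q := (Polynomial.Chebyshev.S K (b - 1)).eval ((d : K) + (d⁻¹ : Kˣ))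
    set α := ((e ^ a : Kˣ) : K)
    set α' := (((e ^ a)⁻¹ : Kˣ) : K)
    set β := ((d ^ b : Kˣ) : K)
    set β' := (((d ^ b)⁻¹ : Kˣ) : K)
    have hrow0 (j : Fin 2) (k : ℕ) : (M 0 j).coeff (k + 1) = α * β * (N.1 0 j).coeff (k + 1) +
        P * Q * ((N.1 0 j).coeff k - (N.1 0 j).coeff (k + 1) * κ) +
        P * β' * ((N.1 1 j).coeff k - (N.1 1 j).coeff (k + 1) * κ) := by
      have : M 0 j = Polynomial.C (α * β) * N.1 0 j +
          Polynomial.C (P * Q) * ((Polynomial.X - Polynomial.C κ) * N.1 0 j) +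
          Polynomial.C (P * β') * ((Polynomial.X - Polynomial.C κ) * N.1 1 j) := by
        rw [hM, Matrix.mul_apply, Fin.sum_univ_two]
        simp
        ring
      rw [this]
      simp only [Polynomial.coeff_add, Polynomial.coeff_C_mul, Polynomial.coeff_X_sub_C_mul]
      ring
    have hrow1 (j : Fin 2) (k : ℕ) : (M 1 j).coeff k = α' * Q * (N.1 0 j).coeff k +
        α' * β' * (N.1 1 j).coeff k := by
      have : M 1 j = Polynomial.C (α' * Q) * N.1 0 j + Polynomial.C (α' * β') * N.1 1 j := by
        rw [hM, Matrix.mul_apply, Fin.sum_univ_two]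
        simp
      rw [this]
      simp only [Polynomial.coeff_add, Polynomial.coeff_C_mul]
    rw [List.length_cons, List.map_cons, List.prod_cons]
    refine ⟨⟨fun k hk => ?_, ?_⟩, fun k hk => ?_, fun k hk => ?_, fun k hk h0 => ?_⟩
    · obtain ⟨k, rfl⟩ := Nat.exists_eq_succ_of_ne_zero (by lia : k ≠ 0)
      rw [Nat.succ_eq_add_one, hrow0, h1 _ (by lia), h1 _ (by lia), h4 _ (by lia), h4 _ (by lia)]
      ring
    · rw [hrow0, h1 _ (by lia), h2, h4 _ (by lia), h4 _ (by lia)]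
      ring
    · obtain ⟨k, rfl⟩ := Nat.exists_eq_succ_of_ne_zero (by lia : k ≠ 0)
      rw [Nat.succ_eq_add_one, hrow0, h3 _ (by lia), h3 _ (by lia), h5 _ (by lia) (by lia),
        h5 _ (by lia) (by lia)]
      ring
    · rw [hrow1, h1 _ (by lia), h4 _ (by lia)]
      ring
    · rw [hrow1, h3 _ (by lia), h5 _ (by lia) (by lia)]
      ring

/-- As a polynomial in `u`, the trace polynomial of a nonempty product of `r` syllables has
degree at most `r`, and its coefficient at `u ^ r` is a product of Chebyshev polynomials. -/
theorem coeff_aeval_tracePolynomial {K : Type*} [Field K] (e d : Kˣ) {l : List (ℤ × ℤ)}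
    (hl : l ≠ []) :
    let g : Polynomial K := MvPolynomial.aeval
      ![Polynomial.C ((e : K) + (e⁻¹ : Kˣ)), Polynomial.X, Polynomial.C ((d : K) + (d⁻¹ : Kˣ))]
      (tracePolynomial (syllableProd x y l))
    (∀ k, l.length < k → g.coeff k = 0) ∧
      g.coeff l.length = (l.map fun p =>
        (Polynomial.Chebyshev.S K (p.1 - 1)).eval ((e : K) + (e⁻¹ : Kˣ)) *
        (Polynomial.Chebyshev.S K (p.2 - 1)).eval ((d : K) + (d⁻¹ : Kˣ))).prod := by
  intro g
  -- The shift for which the trace of the product of the two matrices is exactly `X`.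
  let κ : K := e * d + (e⁻¹ : Kˣ) * (d⁻¹ : Kˣ)
  obtain ⟨⟨h1, h2⟩, -, -, h5⟩ := coeff_syllableProd e d κ l
  have h := (tracePolynomial_spec (syllableProd x y l)).trace_eq
    (upper (Units.map Polynomial.C.toMonoidHom e) (Polynomial.X - Polynomial.C κ))
    (lower (Units.map Polynomial.C.toMonoidHom d) 1)
  have hv : ![trace (upper (Units.map Polynomial.C.toMonoidHom e) (Polynomial.X - Polynomial.C κ)).1,
      trace (upper (Units.map Polynomial.C.toMonoidHom e) (Polynomial.X - Polynomial.C κ) *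
        lower (Units.map Polynomial.C.toMonoidHom d) 1).1,
      trace (lower (Units.map Polynomial.C.toMonoidHom d) 1).1] =
      ![Polynomial.C ((e : K) + (e⁻¹ : Kˣ)), Polynomial.X,
        Polynomial.C ((d : K) + (d⁻¹ : Kˣ))] := by
    have hi (e : Kˣ) : (((Units.map Polynomial.C.toMonoidHom e)⁻¹ : (Polynomial K)ˣ) :
        Polynomial K) = Polynomial.C ((e⁻¹ : Kˣ) : K) := rfl
    have hi' (e : Kˣ) : ((Units.map Polynomial.C.toMonoidHom e : (Polynomial K)ˣ) :
        Polynomial K) = Polynomial.C (e : K) := rfl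
    rw [val_mul, coe_upper, coe_lower, Matrix.mul_fin_two, hi, hi, hi', hi']
    funext i
    fin_cases i
    · simp [Matrix.trace_fin_two]
    · simp only [κ, Matrix.trace_fin_two_of, Polynomial.C_add, Polynomial.C_mul, Fin.mk_one,
        Matrix.cons_val_one, Matrix.cons_val_zero]
      ring
    · simp [Matrix.trace_fin_two]
  replace h := h.symm
  rw [hv, wordValue_syllableProd, Matrix.trace_fin_two] at h
  have hr := List.length_pos_iff.2 hl
  change g = _ at h
  rw [h]
  simp only [Polynomial.coeff_add]
  exact ⟨fun k hk => by rw [h1 k hk, h5 k (by lia) (by lia), add_zero],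
    by rw [h2, h5 _ le_rfl (by lia), add_zero]⟩

open Polynomial

/-! ### Roots of `S_{a-1}` and their multiplicities. -/

theorem exists_units_add_inv {K : Type*} [Field K] [IsAlgClosed K] (s : K) :
    ∃ e : Kˣ, (e : K) + (e⁻¹ : Kˣ) = s := by
  obtain ⟨b, hb⟩ := IsAlgClosed.exists_root (X ^ 2 - C s * X + 1 : K[X]) (by
    have : (X ^ 2 - C s * X + 1 : K[X]).degree = 2 := by compute_degree!
    rw [this]; norm_num)
  have hb' : b ^ 2 - s * b + 1 = 0 := by simpa using hb
  have hb0 : b ≠ 0 := by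
    rintro rfl
    simp at hb'
  refine ⟨Units.mk0 b hb0, ?_⟩
  simp
  field_simp
  linear_combination hb'

theorem S_pred_eval_mul {K : Type*} [Field K] (e : Kˣ) (a : ℤ) :
    (Chebyshev.S K (a - 1)).eval ((e : K) + (e⁻¹ : Kˣ)) * (e - (e⁻¹ : Kˣ)) =
      (e ^ a : Kˣ) - (e ^ (-a) : Kˣ) := by
  have h1 := S_eval_units_add_inv e a
  have h2 := S_eval_units_add_inv e⁻¹ a
  rw [inv_inv, add_comm, _root_.inv_zpow'] at h2
  linear_combination h1 - h2

theorem degree_S (K : Type*) [Field K] (n : ℕ) : (Chebyshev.S K n).degree = n := by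
  induction n using Nat.twoStepInduction with
  | zero => simp
  | one => simp
  | more n ih1 ih2 =>
    have h : (X * Chebyshev.S K (n + 1)).degree = ((n + 2 : ℕ) : WithBot ℕ) := by
      rw [degree_mul, degree_X, ← Nat.cast_succ, ih2]
      norm_cast
      ring
    push_cast at *
    rw [Chebyshev.S_add_two, degree_sub_eq_left_of_degree_lt, h]
    rw [h, ih1]
    norm_cast
    lia

theorem S_pred_ne_zero {K : Type*} [Field K] {a : ℤ} (ha : a ≠ 0) : Chebyshev.S K (a - 1) ≠ 0 := by
  have hnat (n : ℕ) (hn : n ≠ 0) : Chebyshev.S K (n - 1) ≠ 0 := by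
    obtain ⟨k, rfl⟩ := Nat.exists_eq_succ_of_ne_zero hn
    intro h
    have := degree_S K k
    simp at h
    simp [h] at this
  rcases Int.natAbs_eq a with h | h
  · rw [h]
    exact hnat _ (by simpa using ha)
  · rw [h, Chebyshev.S_neg_sub_one]
    exact neg_ne_zero.2 (hnat _ (by simpa using ha))

/-- At a common root of `S_n` and its derivative this leaves `2 (n + 1) S_{n+1} = 0`, the input for
simplicity of roots. -/
theorem sub_four_mul_derivative_S (R : Type*) [CommRing R] (n : ℤ) :
    (X ^ 2 - 4) * derivative (Chebyshev.S R n) =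
      ((n : R[X]) + 1) * (2 * Chebyshev.S R (n + 1) - X * Chebyshev.S R n) -
        X * Chebyshev.S R n := by
  induction n using Polynomial.Chebyshev.induct with
  | zero => simp; ring
  | one => simp [Chebyshev.S_two]; ring
  | add_two n ih1 ih2 =>
    have h1 := Chebyshev.S_add_two R n
    have h2 := Chebyshev.S_add_two R (n + 1)
    have h3 := congrArg derivative h1
    simp only [derivative_sub, derivative_mul, derivative_X] at h3
    rw [show (n : ℤ) + 1 + 2 = n + 2 + 1 by ring, show (n : ℤ) + 1 + 1 = n + 2 by ring] at *
    push_cast at *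
    rw [h3, h2]
    rw [h1] at *
    linear_combination X * ih1 - ih2
  | neg_add_one n ih1 ih2 =>
    have h1 := Chebyshev.S_sub_one R (-n)
    have h2 := Chebyshev.S_add_two R (-n)
    have h3 := congrArg derivative h1
    simp only [derivative_sub, derivative_mul, derivative_X] at h3
    rw [show -(n : ℤ) - 1 + 1 = - n by ring]
    rw [show -(n : ℤ) + 1 + 1 = -n + 2 by ring, h2] at ih2
    rw [h3, h1]
    push_cast at *
    linear_combination X * ih1 - ih2

theorem rootMultiplicity_S_pred {K : Type*} [Field K] {a : ℤ} (ha : a ≠ 0) (ha' : (2 * a : K) ≠ 0)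
    {s : K} (hs : (Chebyshev.S K (a - 1)).eval s = 0) :
    (Chebyshev.S K (a - 1)).rootMultiplicity s = 1 := by
  have h0 := S_pred_ne_zero (K := K) ha
  apply le_antisymm
  -- At a double root `2 a S_a(s) = 0`, whereas `S_{a-1}² + S_a² - X S_{a-1} S_a = 1` forces
  -- `S_a(s)² = 1`.
  · by_contra! h
    rw [one_lt_rootMultiplicity_iff_isRoot h0] at h
    have h1 := congrArg (eval s) (sub_four_mul_derivative_S K (a - 1))
    have h2 := congrArg (eval s) (Chebyshev.S_sq_add_S_sq K (a - 1))
    simp [h.2.eq_zero, hs] at h1 h2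
    rcases h1 with h1 | h1 | h1
    · exact ha' (by simp [h1])
    · exact ha' (by simp [h1])
    · simp [h1] at h2
  · exact (rootMultiplicity_pos h0).2 hs

/-- As `e ≠ e⁻¹`, vanishing means `e^a = e^(-a)`, that is `e^(2a) = 1`; hence the order `2d`. -/
theorem S_pred_eval_primitiveRoot_eq_zero_iff {K : Type*} [Field K] {d : ℕ} (hd : 2 ≤ d) {e : Kˣ}
    (he : IsPrimitiveRoot e (2 * d)) (a : ℤ) :
    (Chebyshev.S K (a - 1)).eval ((e : K) + (e⁻¹ : Kˣ)) = 0 ↔ (d : ℤ) ∣ a := by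
  have h := S_pred_eval_mul e a
  have hne : (e : K) - (e⁻¹ : Kˣ) ≠ 0 := by
    rw [sub_ne_zero]
    intro h
    have h2 : e ^ 2 = 1 := by
      rw [sq]
      nth_rw 1 [Units.ext h]
      simp
    have := Nat.le_of_dvd (by norm_num) ((he.pow_eq_one_iff_dvd 2).1 h2)
    lia
  rw [← mul_eq_zero_iff_right hne, h, sub_eq_zero, Units.val_inj, _root_.zpow_neg, eq_inv_iff_mul_eq_one,
    ← _root_.zpow_add, he.zpow_eq_one_iff_dvd, ← two_mul]
  push_cast
  exact mul_dvd_mul_iff_left (by norm_num)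

theorem rootMultiplicity_prod_S {K : Type*} [Field K] {d : ℕ} (hd : 2 ≤ d) {e : Kˣ}
    (he : IsPrimitiveRoot e (2 * d)) (L : List ℤ) (hL : ∀ a ∈ L, a ≠ 0)
    (hL' : ∀ a ∈ L, (2 * a : K) ≠ 0) :
    (L.map fun a => Chebyshev.S K (a - 1)).prod ≠ 0 ∧
    (L.map fun a => Chebyshev.S K (a - 1)).prod.rootMultiplicity ((e : K) + (e⁻¹ : Kˣ)) =
      (L.map Int.natAbs).countP (d ∣ ·) := by
  induction L with
  | nil => simp
  | cons a L ih =>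
    obtain ⟨ih1, ih2⟩ := ih (fun b hb => hL b (by simp [hb])) (fun b hb => hL' b (by simp [hb]))
    have h0 := S_pred_ne_zero (K := K) (hL a (by simp))
    have hz := S_pred_eval_primitiveRoot_eq_zero_iff hd he a
    rw [List.map_cons, List.prod_cons, List.map_cons, List.countP_cons]
    refine ⟨mul_ne_zero h0 ih1, ?_⟩
    rw [rootMultiplicity_mul (mul_ne_zero h0 ih1), ih2, add_comm]
    congr 1
    by_cases h : (d : ℤ) ∣ a
    · rw [rootMultiplicity_S_pred (hL a (by simp)) (hL' a (by simp)) (hz.2 h)]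
      simp [← Int.natCast_dvd, h]
    · rw [rootMultiplicity_eq_zero (mt hz.1 h)]
      simp [← Int.natCast_dvd, h]

/-! ### Recognising an `n`-fold repetition from divisor counts. -/

/-- If the number of entries divisible by `d` is a multiple of `n` for every entry `d`, then
the list is a rearrangement of an `n`-fold repetition. -/
theorem exists_perm_flatten_replicate (n : ℕ) (hn : n ≠ 0) (L : List ℕ) (hL : ∀ d ∈ L, d ≠ 0)
    (h : ∀ d ∈ L, n ∣ L.countP (d ∣ ·)) :
    ∃ M : List ℕ, L.Perm (List.replicate n M).flatten := by
  induction hk : L.length using Nat.strong_induction_on generalizing L with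
  | _ k ih =>
    rcases eq_or_ne L [] with rfl | hne
    · exact ⟨[], by simp⟩
    -- The only multiples of the largest entry `d` in the list are its own copies, so their number
    -- is a multiple of `n`. Deleting them all changes every divisor count by a multiple of `n`, and
    -- induction applies.
    obtain ⟨d, hd, hmax⟩ := L.toFinset.exists_max_image id (by
      simpa [Finset.nonempty_iff_ne_empty] using hne)
    simp only [List.mem_toFinset, id] at hd hmax
    have hcount : L.countP (d ∣ ·) = L.count d := by
      refine List.countP_congr fun b hb => ?_
      simp only [decide_eq_true_eq, beq_iff_eq]
      constructor
      · intro hdb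
        exact le_antisymm (hmax b hb) (Nat.le_of_dvd (Nat.pos_of_ne_zero (hL b hb)) hdb)
      · rintro rfl
        rfl
    obtain ⟨c, hc⟩ := hcount ▸ h d hd
    have hsplit : L.Perm (List.replicate (n * c) d ++ L.filter (! · == d)) := by
      have := (List.filter_append_perm (· == d) L).symm
      rwa [List.filter_beq, hc] at this
    obtain ⟨M, hM⟩ := ih (L.filter (! · == d)).length (by
      rw [← hk, hsplit.length_eq]
      have : 0 < L.count d := List.count_pos_iff.2 hd
      simp
      lia) (L.filter (! · == d)) (fun b hb => hL b (List.mem_of_mem_filter hb)) (fun b hb => by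
        have h1 := h b (List.mem_of_mem_filter hb)
        rw [hsplit.countP_eq, List.countP_append] at h1
        refine (Nat.dvd_add_right ?_).1 h1
        rw [List.countP_replicate]
        split_ifs
        · exact dvd_mul_right _ _
        · exact dvd_zero _) rfl
    refine ⟨List.replicate c d ++ M, hsplit.trans ?_⟩
    refine (hM.append_left _).trans ?_
    clear * -
    induction n with
    | zero => simp
    | succ n ih =>
      rw [List.replicate_succ, List.flatten_cons, List.replicate_succ, List.flatten_cons, add_mul,
        one_mul, add_comm, List.replicate_add]
      simp only [List.append_assoc]
      refine List.Perm.append_left _ ?_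
      refine (List.perm_append_comm_assoc _ _ _).trans (ih.append_left M)

/-! ### The leading coefficient of a composition. -/

/-- Letting `s` and `t` be polynomials keeps one of them variable, so root multiplicities make
sense. Identities are checked at each point of the infinite field `K`, where both traces have the
form `e + e⁻¹`. -/
theorem coeff_aeval_tracePolynomialOver {F K : Type*} [Field F] [Field K] [IsAlgClosed K]
    [Algebra F K] {l : List (ℤ × ℤ)} (hl : l ≠ []) (s t : K[X]) :
    let G : K[X][X] := MvPolynomial.aeval ![C s, X, C t] (tracePolynomialOver F (syllableProd x y l))
    (∀ k, l.length < k → G.coeff k = 0) ∧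
      G.coeff l.length = (l.map fun p =>
        (Chebyshev.S K (p.1 - 1)).comp s * (Chebyshev.S K (p.2 - 1)).comp t).prod := by
  intro G
  have key (z : K) : G.map (evalRingHom z) = MvPolynomial.aeval
      ![C (s.eval z), X, C (t.eval z)] (tracePolynomial (syllableProd x y l)) := by
    rw [← coe_mapRingHom]
    simp only [G, aeval_tracePolynomialOver]
    rw [MvPolynomial.aeval_def, MvPolynomial.hom_eval₂, MvPolynomial.aeval_def]
    congr 1
    · exact RingHom.ext_int _ _
    · funext i
      fin_cases i <;> simp
  have hG (z : K) (k : ℕ) : (G.coeff k).eval z = (MvPolynomial.aeval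
      ![C (s.eval z), X, C (t.eval z)] (tracePolynomial (syllableProd x y l)) : K[X]).coeff k := by
    rw [← key, coeff_map, coe_evalRingHom]
  constructor
  · intro k hk
    refine Polynomial.funext fun z => ?_
    obtain ⟨e, he⟩ := exists_units_add_inv (s.eval z)
    obtain ⟨d, hd⟩ := exists_units_add_inv (t.eval z)
    rw [hG, ← he, ← hd, (coeff_aeval_tracePolynomial e d hl).1 k hk, eval_zero]
  · refine Polynomial.funext fun z => ?_
    obtain ⟨e, he⟩ := exists_units_add_inv (s.eval z)
    obtain ⟨d, hd⟩ := exists_units_add_inv (t.eval z)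
    rw [hG, ← he, ← hd, (coeff_aeval_tracePolynomial e d hl).2, eval_list_prod, List.map_map]
    simp only [Function.comp_def, eval_mul, eval_comp, he, hd]

theorem exists_eval_S_ne_zero (K : Type*) [Field K] [Infinite K] (L : List ℤ)
    (hL : ∀ a ∈ L, a ≠ 0) : ∃ t : K, (L.map fun a => (Chebyshev.S K (a - 1)).eval t).prod ≠ 0 := by
  by_contra! h
  have h0 : (L.map fun a => Chebyshev.S K (a - 1)).prod = 0 := by
    refine Polynomial.funext fun t => ?_
    rw [eval_list_prod, List.map_map, eval_zero]
    exact h t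
  rw [List.prod_eq_zero_iff, List.mem_map] at h0
  obtain ⟨a, ha, h0⟩ := h0
  exact S_pred_ne_zero (hL a ha) h0

/-- If the trace polynomial is `h(q)`, then its leading coefficient in `u` is, up to a constant,
a power with exponent the degree of `h`. -/
theorem exists_leadingCoeff_eq_pow {F K : Type*} [Field F] [Field K] [IsAlgClosed K]
    [Algebra F K] {l : List (ℤ × ℤ)} (hl : l ≠ []) {h : F[X]} {q : MvPolynomial (Fin 3) F}
    (hcomp : tracePolynomialOver F (syllableProd x y l) = aeval q h) (s t : K[X])
    (hne : (l.map fun p =>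
      (Chebyshev.S K (p.1 - 1)).comp s * (Chebyshev.S K (p.2 - 1)).comp t).prod ≠ 0) :
    h.natDegree ∣ l.length ∧ ∃ k : K, ∃ Q : K[X], (l.map fun p =>
      (Chebyshev.S K (p.1 - 1)).comp s * (Chebyshev.S K (p.2 - 1)).comp t).prod =
        C k * Q ^ h.natDegree := by
  obtain ⟨h1, h2⟩ := coeff_aeval_tracePolynomialOver (F := F) hl s t
  set G : K[X][X] :=
    MvPolynomial.aeval ![C s, X, C t] (tracePolynomialOver F (syllableProd x y l)) with hGdef
  set Q : K[X][X] := MvPolynomial.aeval ![C s, X, C t] q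
  have hG : G = (h.map (algebraMap F K[X])).comp Q := by
    rw [hGdef, hcomp, ← Polynomial.aeval_algHom_apply, Polynomial.comp, eval₂_map, aeval_def]
    rfl
  have hdeg : G.natDegree = l.length := natDegree_eq_of_le_of_coeff_ne_zero
    (natDegree_le_iff_coeff_eq_zero.2 h1) (h2 ▸ hne)
  have hlc : G.leadingCoeff = (l.map fun p =>
      (Chebyshev.S K (p.1 - 1)).comp s * (Chebyshev.S K (p.2 - 1)).comp t).prod := by
    rw [← h2, leadingCoeff, hdeg]
  have hinj : Function.Injective (algebraMap F K[X]) := (algebraMap F K[X]).injective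
  have hdeg' := hdeg
  rw [hG, natDegree_comp, natDegree_map_eq_of_injective hinj] at hdeg'
  -- The degree in `u` is `r = n * deg Q` with `r > 0`, so `Q` is nonconstant and the leading
  -- coefficient of `h(Q)` is that of `h` times the `n`-th power of that of `Q`.
  have hQ : Q.natDegree ≠ 0 := by
    intro hQ
    rw [hQ, mul_zero] at hdeg'
    exact hl (List.length_eq_zero_iff.1 hdeg'.symm)
  refine ⟨⟨_, hdeg'.symm⟩, algebraMap F K h.leadingCoeff, Q.leadingCoeff, ?_⟩
  rw [← hlc, hG, leadingCoeff_comp hQ, leadingCoeff_map_of_injective hinj,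
    natDegree_map_eq_of_injective hinj]
  rfl

theorem dvd_countP_of_prod_S_eq_pow {K : Type*} [Field K] [IsAlgClosed K] {L : List ℤ}
    (hL : ∀ a ∈ L, a ≠ 0) (hchar : ringChar K = 0 ∨ ∀ a ∈ L, |a| < (ringChar K : ℤ)) {n : ℕ}
    (hn : n ∣ L.length) {c k : K} (hc : c ≠ 0) {Q : K[X]}
    (h : (L.map fun a => Chebyshev.S K (a - 1)).prod * C c = C k * Q ^ n) (d : ℕ)
    (hd : d ∈ L.map Int.natAbs) : n ∣ (L.map Int.natAbs).countP (d ∣ ·) := by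
  obtain ⟨a₀, ha₀, rfl⟩ := List.mem_map.1 hd
  have hne (a : ℤ) (ha : a ∈ L) : (a : K) ≠ 0 := by
    rw [Ne, CharP.intCast_eq_zero_iff K (ringChar K)]
    intro hdvd
    rcases hchar with h0 | hlt
    · rw [h0] at hdvd
      exact hL a ha (by simpa using hdvd)
    · exact hL a ha (Int.eq_zero_of_abs_lt_dvd hdvd (hlt a ha))
  -- For `d = 1` the primitive second root gives `e = e⁻¹` and the root argument breaks down; but
  -- then every entry is counted and `n ∣ r` suffices.
  rcases Nat.lt_or_ge a₀.natAbs 2 with h1 | h2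
  · have : a₀.natAbs = 1 := by
      have := hL a₀ ha₀
      lia
    rw [this]
    simpa using hn
  -- Positive characteristic exceeds `|a₀| ≥ 2`, so it is not `2`; thus `2d` is invertible and a
  -- primitive `2d`-th root exists.
  · have htwo : (2 : K) ≠ 0 := by
      have : ((2 : ℕ) : K) ≠ 0 := by
        rw [Ne, ringChar.spec]
        intro hdvd
        rcases hchar with h0 | hlt
        · simp [h0] at hdvd
        · have := Nat.le_of_dvd (by norm_num) hdvd
          have := hlt a₀ ha₀
          rw [Int.abs_eq_natAbs] at this
          lia
      simpa using this
    have h2d : ((2 * a₀.natAbs : ℕ) : K) ≠ 0 := by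
      rw [Nat.cast_mul, Nat.cast_two]
      refine mul_ne_zero htwo ?_
      have := hne a₀ ha₀
      rcases Int.natAbs_eq a₀ with h | h <;> rw [h] at this <;> simpa using this
    have : NeZero ((2 * a₀.natAbs : ℕ) : K) := ⟨h2d⟩
    obtain ⟨ζ, hζ⟩ := HasEnoughRootsOfUnity.exists_primitiveRoot K (2 * a₀.natAbs)
    obtain ⟨e, rfl⟩ := hζ.isUnit (by lia)
    obtain ⟨hP0, hP⟩ := rootMultiplicity_prod_S h2 (IsPrimitiveRoot.coe_units_iff.1 hζ) L hL
      (fun a ha => mul_ne_zero htwo (hne a ha))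
    have hl0 : (L.map fun a => Chebyshev.S K (a - 1)).prod * C c ≠ 0 :=
      mul_ne_zero hP0 (by simpa using hc)
    classical
    have hm := congrArg (rootMultiplicity ((e : K) + (e⁻¹ : Kˣ))) h
    rw [rootMultiplicity_mul hl0, hP, rootMultiplicity_C, rootMultiplicity_mul (h ▸ hl0),
      rootMultiplicity_C, ← count_roots (Q ^ n), roots_pow, Multiset.count_nsmul, add_zero, zero_add] at hm
    exact ⟨_, hm⟩

/-! ### Assembling the word `v`. -/

theorem syllableProd_flatten_replicate {G : Type*} [Group G] (A B : G) (l : List (ℤ × ℤ)) (n : ℕ) :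
    syllableProd A B (List.replicate n l).flatten = syllableProd A B l ^ n := by
  simp [syllableProd, List.map_flatten, List.prod_flatten]

theorem exists_perm_of_trace_eq_comp {F : Type*} [Field F] {l : List (ℤ × ℤ)} (hl : l ≠ [])
    (hl0 : ∀ p ∈ l, p.1 ≠ 0 ∧ p.2 ≠ 0) {h : F[X]} {q : MvPolynomial (Fin 3) F}
    (hcomp : tracePolynomialOver F (syllableProd x y l) = aeval q h) :
    h.natDegree ∣ l.length ∧
      ((ringChar F = 0 ∨ ∀ p ∈ l, |p.1| < (ringChar F : ℤ) ∧ |p.2| < (ringChar F : ℤ)) →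
        (∃ M : List ℕ, ((l.map Prod.fst).map Int.natAbs).Perm
          (List.replicate h.natDegree M).flatten) ∧
        ∃ M : List ℕ, ((l.map Prod.snd).map Int.natAbs).Perm
          (List.replicate h.natDegree M).flatten) := by
  let K := AlgebraicClosure F
  have h1 (a : ℤ) (ha : a ∈ l.map Prod.fst) : a ≠ 0 := by
    obtain ⟨p, hp, rfl⟩ := List.mem_map.1 ha
    exact (hl0 p hp).1
  have h2 (a : ℤ) (ha : a ∈ l.map Prod.snd) : a ≠ 0 := by
    obtain ⟨p, hp, rfl⟩ := List.mem_map.1 ha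
    exact (hl0 p hp).2
  have hP (L : List ℤ) (hL : ∀ a ∈ L, a ≠ 0) : (L.map fun a => Chebyshev.S K (a - 1)).prod ≠ 0 := by
    rw [Ne, List.prod_eq_zero_iff, List.mem_map]
    rintro ⟨a, ha, h0⟩
    exact S_pred_ne_zero (hL a ha) h0
  -- Values at which one variable can be frozen so that its factors become a nonzero constant.
  obtain ⟨s, hs⟩ := exists_eval_S_ne_zero K _ h1
  obtain ⟨t, ht⟩ := exists_eval_S_ne_zero K _ h2
  have e1 : (l.map fun p => (Chebyshev.S K (p.1 - 1)).comp X *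
      (Chebyshev.S K (p.2 - 1)).comp (C t)).prod =
      ((l.map Prod.fst).map fun a => Chebyshev.S K (a - 1)).prod *
        C ((l.map Prod.snd).map fun a => (Chebyshev.S K (a - 1)).eval t).prod := by
    rw [List.prod_map_mul, map_list_prod]
    simp [Function.comp_def]
  have e2 : (l.map fun p => (Chebyshev.S K (p.1 - 1)).comp (C s) *
      (Chebyshev.S K (p.2 - 1)).comp X).prod =
      ((l.map Prod.snd).map fun a => Chebyshev.S K (a - 1)).prod *
        C ((l.map Prod.fst).map fun a => (Chebyshev.S K (a - 1)).eval s).prod := by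
    rw [List.prod_map_mul, map_list_prod, mul_comm]
    simp [Function.comp_def]
  obtain ⟨hdvd, k, Q, hQ⟩ := exists_leadingCoeff_eq_pow hl hcomp (X : K[X]) (C t) (by
    rw [e1]
    exact mul_ne_zero (hP _ h1) (by simpa using ht))
  obtain ⟨-, k', Q', hQ'⟩ := exists_leadingCoeff_eq_pow hl hcomp (C s) (X : K[X]) (by
    rw [e2]
    exact mul_ne_zero (hP _ h2) (by simpa using hs))
  rw [e1] at hQ
  rw [e2] at hQ'
  have hn : h.natDegree ≠ 0 := by
    intro hn
    rw [hn, zero_dvd_iff] at hdvd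
    exact hl (List.length_eq_zero_iff.1 hdvd)
  refine ⟨hdvd, fun hchar => ⟨?_, ?_⟩⟩
  · refine exists_perm_flatten_replicate _ hn _ (fun d hd => ?_) (dvd_countP_of_prod_S_eq_pow h1 ?_
      (by simpa using hdvd) ht hQ)
    · obtain ⟨a, ha, rfl⟩ := List.mem_map.1 hd
      simpa using h1 a ha
    · rw [← Algebra.ringChar_eq F K]
      refine hchar.imp_right fun hlt a ha => ?_
      obtain ⟨p, hp, rfl⟩ := List.mem_map.1 ha
      exact (hlt p hp).1
  · refine exists_perm_flatten_replicate _ hn _ (fun d hd => ?_) (dvd_countP_of_prod_S_eq_pow h2 ?_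
      (by simpa using hdvd) hs hQ')
    · obtain ⟨a, ha, rfl⟩ := List.mem_map.1 hd
      simpa using h2 a ha
    · rw [← Algebra.ringChar_eq F K]
      refine hchar.imp_right fun hlt a ha => ?_
      obtain ⟨p, hp, rfl⟩ := List.mem_map.1 ha
      exact (hlt p hp).2

/-- Trace-similarity compares the two arrays separately and ignores signs, so any pairing of `M`
with `N`, all exponents positive, serves as `v`. -/
theorem exists_traceSimilar_pow {l : List (ℤ × ℤ)} (hl0 : ∀ p ∈ l, p.1 ≠ 0 ∧ p.2 ≠ 0) {n : ℕ}
    (hn : n ≠ 0) {M N : List ℕ}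
    (hM : ((l.map Prod.fst).map Int.natAbs).Perm (List.replicate n M).flatten)
    (hN : ((l.map Prod.snd).map Int.natAbs).Perm (List.replicate n N).flatten) :
    ∃ v : F₂, HasComplexity v M.length ∧ TraceSimilar (syllableProd x y l) (v ^ n) := by
  have hlM : l.length = n * M.length := by simpa using hM.length_eq
  have hlN : l.length = n * N.length := by simpa using hN.length_eq
  have hMN : M.length = N.length := Nat.eq_of_mul_eq_mul_left (Nat.pos_of_ne_zero hn)
    (hlM.symm.trans hlN)
  let z : List (ℤ × ℤ) := (M.map Nat.cast).zip (N.map Nat.cast)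
  have hz1 : z.map Prod.fst = M.map Nat.cast := List.map_fst_zip (by simp [hMN])
  have hz2 : z.map Prod.snd = N.map Nat.cast := List.map_snd_zip (by simp [hMN])
  have hM0 (a : ℕ) (ha : a ∈ M) : a ≠ 0 := by
    have : a ∈ (l.map Prod.fst).map Int.natAbs := hM.mem_iff.2
      (List.mem_flatten.2 ⟨M, List.mem_replicate.2 ⟨hn, rfl⟩, ha⟩)
    rw [List.map_map] at this
    obtain ⟨p, hp, rfl⟩ := List.mem_map.1 this
    simpa using (hl0 p hp).1
  have hN0 (a : ℕ) (ha : a ∈ N) : a ≠ 0 := by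
    have : a ∈ (l.map Prod.snd).map Int.natAbs := hN.mem_iff.2
      (List.mem_flatten.2 ⟨N, List.mem_replicate.2 ⟨hn, rfl⟩, ha⟩)
    rw [List.map_map] at this
    obtain ⟨p, hp, rfl⟩ := List.mem_map.1 this
    simpa using (hl0 p hp).2
  have hz0 (p : ℤ × ℤ) (hp : p ∈ z) : p.1 ≠ 0 ∧ p.2 ≠ 0 := by
    have hp1 : p.1 ∈ M.map Nat.cast := hz1 ▸ List.mem_map_of_mem hp
    have hp2 : p.2 ∈ N.map Nat.cast := hz2 ▸ List.mem_map_of_mem hp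
    obtain ⟨a, ha, ha'⟩ := List.mem_map.1 hp1
    obtain ⟨b, hb, hb'⟩ := List.mem_map.1 hp2
    rw [← ha', ← hb']
    exact ⟨Nat.cast_ne_zero.2 (hM0 a ha), Nat.cast_ne_zero.2 (hN0 b hb)⟩
  refine ⟨syllableProd x y z, ⟨z, ⟨hz0, rfl⟩, by simp [z, hMN]⟩, l, (List.replicate n z).flatten,
    ⟨hl0, rfl⟩, ⟨fun p hp => ?_, (syllableProd_flatten_replicate x y z n).symm⟩, ?_, ?_, ?_⟩
  · obtain ⟨z', hz', hp⟩ := List.mem_flatten.1 hp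
    exact hz0 p ((List.mem_replicate.1 hz').2 ▸ hp)
  · simp [z, hlM, hMN]
  · have habs : z.map (fun p => |p.1|) = M.map Nat.cast := by
      have := congrArg (List.map fun a : ℤ => |a|) hz1
      simpa [Function.comp_def] using this
    have := hM.map (Nat.cast : ℕ → ℤ)
    simpa [Function.comp_def, List.map_flatten, habs] using this
  · have habs : z.map (fun p => |p.2|) = N.map Nat.cast := by
      have := congrArg (List.map fun a : ℤ => |a|) hz2
      simpa [Function.comp_def] using this
    have := hN.map (Nat.cast : ℕ → ℤ)
    simpa [Function.comp_def, List.map_flatten, habs] using this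

end TraceWord

theorem proposition4p11 {F : Type*} [Field F] (w : TraceWord.F₂) (l : List (ℤ × ℤ))
    (hw : TraceWord.IsCanonicalForm w l) (h : Polynomial F) (q : MvPolynomial (Fin 3) F) (n : ℕ)
    (hn : h.degree = n) (hcomp : TraceWord.tracePolynomialOver F w = Polynomial.aeval q h) :
    ∃ m : ℕ, l.length = n * m ∧
      ((ringChar F = 0 ∨ ∀ p ∈ l, |p.1| < (ringChar F : ℤ) ∧ |p.2| < (ringChar F : ℤ)) →
        ∃ v : TraceWord.F₂, TraceWord.HasComplexity v m ∧ TraceWord.TraceSimilar w (v ^ n)) := by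
  obtain ⟨hl0, rfl⟩ := hw
  rcases eq_or_ne l [] with rfl | hl
  -- For the empty word `n` is unconstrained, even `0`; `m = 0` and `v = 1` work.
  · exact ⟨0, by simp, fun _ => ⟨1, ⟨[], ⟨by simp, by simp⟩, rfl⟩, [], [], ⟨by simp, by simp⟩,
      ⟨by simp, by simp⟩, by simp, by simp, by simp⟩⟩
  obtain rfl : h.natDegree = n := Polynomial.natDegree_eq_of_degree_eq_some hn
  obtain ⟨⟨m, hm⟩, hperm⟩ := TraceWord.exists_perm_of_trace_eq_comp hl hl0 hcomp
  refine ⟨m, hm, fun hchar => ?_⟩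
  have hn0 : h.natDegree ≠ 0 := by
    intro hn0
    rw [hn0, zero_mul] at hm
    exact hl (List.length_eq_zero_iff.1 hm)
  obtain ⟨⟨M, hM⟩, N, hN⟩ := hperm hchar
  have hlM : l.length = h.natDegree * M.length := by simpa using hM.length_eq
  obtain rfl : m = M.length := Nat.eq_of_mul_eq_mul_left (Nat.pos_of_ne_zero hn0)
    (hm.symm.trans hlM)
  exact TraceWord.exists_traceSimilar_pow hl0 hn0 hM hN
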